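/- A deterministic finite automaton (DFA) consists of a finite state set $Q$, a finite alphabet $\Sigma$ and a transition map $\delta\colon Q\times\Sigma\to Q$ (no initial or final states); write $qa=\delta(q,a)$, extended to words read from left to right. A word $w$ is synchronizing if $qw$ is the same state for all $q\in Q$. A DFA on $n$ states is critical if it has a synchronizing word and its shortest synchronizing word has length exactly $(n-1)^2$; it is super-critical if it has a synchronizing word and its shortest one has length greater than $(n-1)^2$. It is basic if distinct symbols induce distinct maps $Q\to Q$ and no symbol induces the identity. Two DFAs are isomorphic if they agree up to a bijective renaming of states and of symbols. Consider the following DFAs with state set $\{1,2,3,4\}$, each symbol being given by its list of images of $1,2,3,4$: - $C_4$: $a=(2,3,4,1)$, $b=(2,2,3,4)$; - T4-2: $a=(4,3,1,3)$, $b=(1,2,4,3)$, $c=(3,4,1,2)$; - A4: $a=(2,4,3,1)$, $b=(3,2,1,3)$, $c=(1,2,3,1)$, $d=(4,2,3,1)$, $e=(2,1,3,4)$. **Theorem.** No super-critical DFA on four states exists. A basic DFA on four states is critical (that is, its shortest synchronizing word has length $9$) if and only if it is isomorphic to $C_4$, to T4-2, or to one of the DFAs obtained from A4 by removing zero or more symbols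 while keeping at least all symbols of $\{a,b\}$ or all symbols of $\{b,d,e\}$. There are exactly $10$ such symbol sets, and the $10$ resulting DFAs are pairwise non-isomorphic. -/

import Mathlib

universe u v w x

/-- A deterministic automaton with state set `Q` and alphabet `A`, without initial and final
states (these play no role for synchronization). -/
structure Automaton (Q : Type u) (A : Type v) where
  /-- The transition function `(q, a) ↦ δ(q, a)`. -/
  step : Q → A → Q

namespace Automaton

variable {Q : Type u} {A : Type v}

/-- The state `q w` reached from `q` after processing the word `w` from left to right. -/
def run (M : Automaton Q A) (q : Q) (w : List A) : Q :=
  w.foldl M.step q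

/-- The word `w` sends all states to one and the same state. -/
def IsSynchronizingWord (M : Automaton Q A) (w : List A) : Prop :=
  ∃ s : Q, ∀ q : Q, M.run q w = s

/-- A synchronizing word exists, and the shortest ones have length `l`. -/
def HasSyncLength (M : Automaton Q A) (l : ℕ) : Prop :=
  IsLeast {k : ℕ | ∃ w : List A, M.IsSynchronizingWord w ∧ w.length = k} l

/-- The shortest synchronizing word has length `(n - 1) ^ 2`, where `n` is the number of states. -/
def IsCritical (M : Automaton Q A) : Prop :=
  M.HasSyncLength ((Nat.card Q - 1) ^ 2)

/-- The automaton is synchronizing and its shortest synchronizing word has length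
greater than `(n - 1) ^ 2`, where `n` is the number of states. -/
def IsSuperCritical (M : Automaton Q A) : Prop :=
  ∃ l : ℕ, M.HasSyncLength l ∧ (Nat.card Q - 1) ^ 2 < l

/-- Distinct symbols act differently on the states, and no symbol acts as the identity. -/
def IsBasic (M : Automaton Q A) : Prop :=
  Function.Injective (fun (a : A) (q : Q) => M.step q a) ∧
    ∀ a : A, (fun q : Q => M.step q a) ≠ id

/-- Two automata are isomorphic: they agree up to renaming states and symbols. -/
def Isomorphic {Q' : Type w} {A' : Type x} (M : Automaton Q A) (N : Automaton Q' A') : Prop :=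
  ∃ (e : Q ≃ Q') (f : A ≃ A'), ∀ (q : Q) (a : A), e (M.step q a) = N.step (e q) (f a)

/-- The automaton obtained by keeping only the symbols in `S`. -/
def restrict (M : Automaton Q A) (S : Finset A) : Automaton Q {a : A // a ∈ S} where
  step q a := M.step q a.1

end Automaton

/-- The alphabet of the Černý automata. -/
inductive CernyLetter
  | a | b
  deriving DecidableEq

instance : Fintype CernyLetter :=
  ⟨{.a, .b}, by intro x; cases x <;> decide⟩

/-- The Černý automaton `C_n` (`n ≥ 2`); the state `i : Fin n` stands for the state `i + 1` of
`{1, …, n}`. The symbol `a` is the cyclic shift, and `b` sends the state `1` to `2` and fixes all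
other states. -/
def cernyAutomaton (n : ℕ) [NeZero n] : Automaton (Fin n) CernyLetter where
  step q s :=
    match s with
    | .a => q + 1
    | .b => if q = 0 then 1 else q

/-- The alphabet of `T4-2`. -/
inductive T42Letter
  | a | b | c
  deriving DecidableEq

instance : Fintype T42Letter :=
  ⟨{.a, .b, .c}, by intro x; cases x <;> decide⟩

/-- The automaton `T4-2`; the state `i : Fin 4` stands for the state `i + 1` of `{1, 2, 3, 4}`. -/
def automatonT42 : Automaton (Fin 4) T42Letter where
  step q s :=
    match s with
    | .a => ![3, 2, 0, 2] q
    | .b => ![0, 1, 3, 2] q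
    | .c => ![2, 3, 0, 1] q

/-- The alphabet of `A4`. -/
inductive A4Letter
  | a | b | c | d | e
  deriving DecidableEq

instance : Fintype A4Letter :=
  ⟨{.a, .b, .c, .d, .e}, by intro x; cases x <;> decide⟩

/-- The automaton `A4`; the state `i : Fin 4` stands for the state `i + 1` of `{1, 2, 3, 4}`. -/
def automatonA4 : Automaton (Fin 4) A4Letter where
  step q s :=
    match s with
    | .a => ![1, 3, 2, 0] q
    | .b => ![2, 1, 0, 2] q
    | .c => ![0, 1, 2, 0] q
    | .d => ![3, 1, 2, 0] q
    | .e => ![1, 0, 2, 3] q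

/-- The sets of symbols of `A4` that contain `{a, b}` or `{b, d, e}`. -/
def keptSets : Finset (Finset A4Letter) :=
  Finset.univ.filter fun S =>
    ({A4Letter.a, A4Letter.b} : Finset A4Letter) ⊆ S ∨
      ({A4Letter.b, A4Letter.d, A4Letter.e} : Finset A4Letter) ⊆ S

/-!
### Transformations of four points as numbers

A set `s` of points of `Fin 4` is represented by the number `mask s = ∑ i ∈ s, 2 ^ i`, and a
transformation `f` by its code: the table, written in base 16, of the numbers
`mask (f '' s)`. The functions below are evaluated by the kernel. Those in the inner loops are
therefore written with recursors, and they pass their results to continuations.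
-/

/-! Synchronization of a four-state automaton depends only on the set `T` of non-identity
transformations induced by its symbols, so the theorem reduces to finding all `T` that synchronize
but have no word of length at most eight.

The search grows a set `S ⊆ T` inside a pool of candidates. Having a short word is monotone in the
symbol set, so every candidate that gives `S` a short word is discarded. If `S` is not
synchronizing, some family of non-singleton sets contains the full set and is closed under `S`; a
synchronizing `T` must contain a transformation that leaves this family, and only those are branched
on. Up to renumbering the states, `S` starts from one representative of a class of non-bijective
maps. `search_sound` proves the method correct, `check_eq_true` runs it, and `exists_accept` is the
outcome: `T` lies between a core and a maximal set of one of four `families`.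

Every core has a word of length at most 9 (`families_syncWithin`), and no maximal set has one of
length at most 8 (`families_not_syncWithin`). By monotonicity everything in between has length
exactly 9. This rules out super-critical automata and shows that the listed ones are critical.
Non-isomorphism holds because `b` is rigid inside `A4` (`conjugate_b`). -/

namespace TransformationCode

/-- The image of the set with mask `m` under the transformation with code `t`. -/
def act (t m : ℕ) : ℕ := Nat.land (Nat.shiftRight t (Nat.mul 4 m)) 15

/-- Membership of `m` in the set of numbers given by the binary digits of `F`. -/
def hasBit (F m : ℕ) : Bool := Nat.beq (Nat.land (Nat.shiftRight F m) 1) 1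

/-- The set of the masks of singletons. -/
def points : ℕ := 278

/-- The masks of the sets with at least two elements. -/
def masks : List ℕ := [3, 5, 6, 9, 10, 12, 7, 11, 13, 14, 15]

/-- Apply `k` to the value of `n`, evaluating `n` first. -/
def force (n : ℕ) (k : ℕ → Bool) : Bool :=
  Nat.rec (motive := fun _ => Bool) (k 0) (fun m _ => k (Nat.succ m)) n

/-- Visit the images of `m` under the transformations in `S`; those that are not in `v` are added
to `v` and to the list `n`. Leave through `hit` when a singleton is met. -/
def visitOne (hit : Unit → Bool) (m : ℕ) (S : List ℕ) :
    ℕ → List ℕ → (ℕ → List ℕ → Bool) → Bool :=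
  List.rec (motive := fun _ => ℕ → List ℕ → (ℕ → List ℕ → Bool) → Bool) (fun v n k => k v n)
    (fun t _ ih v n k => force (act t m) fun x =>
      Bool.rec (Bool.rec (force (Nat.lor v (Nat.shiftLeft 1 x)) fun v' => ih v' (x :: n) k)
        (hit ()) (hasBit points x)) (ih v n k) (hasBit v x)) S

/-- Visit the images of all masks in the list `fr`. -/
def visitAll (hit : Unit → Bool) (S fr : List ℕ) : ℕ → List ℕ → (ℕ → List ℕ → Bool) → Bool :=
  List.rec (motive := fun _ => ℕ → List ℕ → (ℕ → List ℕ → Bool) → Bool) (fun v n k => k v n)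
    (fun m _ ih v n k => visitOne hit m S v n fun v' n' => ih v' n' k) fr

/-- Breadth-first search with `K` rounds; `fin` receives the set of all masks that were visited. -/
def bfs (hit : Unit → Bool) (fin : ℕ → Bool) (S : List ℕ) (K : ℕ) : ℕ → List ℕ → Bool :=
  Nat.rec (motive := fun _ => ℕ → List ℕ → Bool) (fun v _ => fin v)
    (fun _ ih v fr => visitAll hit S fr v [] ih) K

/-- Some word of length at most eight over `S` is synchronizing. -/
def short (S : List ℕ) : Bool := bfs (fun _ => true) (fun _ => false) S 8 32768 [15]

/-- Some transformation in `S` maps `m` out of `F`. -/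
def leaves (F m : ℕ) (S : List ℕ) : Bool :=
  List.rec (motive := fun _ => Bool) false (fun t _ ih => Bool.rec true ih (hasBit F (act t m))) S

/-- Remove the masks in the list `ms` that leave `F` from `F`. -/
def shrinkOnce (S ms : List ℕ) : ℕ → (ℕ → Bool) → Bool :=
  List.rec (motive := fun _ => ℕ → (ℕ → Bool) → Bool) (fun F k => k F)
    (fun m _ ih F k => Bool.rec (ih F k)
      (Bool.rec (ih F k) (force (Nat.sub F (Nat.shiftLeft 1 m)) fun F' => ih F' k) (leaves F m S))
      (hasBit F m)) ms

/-- Remove masks from `F` until it is closed under `S`. -/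
def shrink (S : List ℕ) : ℕ → ℕ → (ℕ → Bool) → Bool
  | 0, F, k => k F
  | n + 1, F, k => shrinkOnce S masks F fun F' => cond (Nat.beq F F') (k F) (shrink S n F' k)

/-- The transformation `t` maps one of the masks in the list `ms` out of `F`. -/
def escapesFrom (F t : ℕ) (ms : List ℕ) : Bool :=
  List.rec (motive := fun _ => Bool) false
    (fun m _ ih => Bool.rec ih (Bool.rec true ih (hasBit F (act t m))) (hasBit F m)) ms

/-- The transformation `t` does not preserve the family `F` of masks. -/
def escapes (F t : ℕ) : Bool := escapesFrom F t masks

/-- `F` is closed under `S`, contains the full set, and contains no set with less than two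
elements. -/
def closedUnder (F : ℕ) (S : List ℕ) : Bool :=
  cond (hasBit F 15) (cond (Nat.beq (Nat.land F 279) 0) (S.all fun t => !escapes F t) false) false

/-- Split a list into the elements with the property `p` and those without it. -/
def split (p : ℕ → Bool) : List ℕ → List ℕ → List ℕ → (List ℕ → List ℕ → Bool) → Bool
  | [], y, n, k => k y n
  | t :: C, y, n, k => cond (p t) (split p C (t :: y) n k) (split p C y (t :: n) k)

/-- Move the elements of the first list to the second one. -/
def moveAll : List ℕ → List ℕ → (List ℕ → Bool) → Bool
  | [], r, k => k r
  | t :: C, r, k => moveAll C (t :: r) k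

/-- Add the elements of a list to `S` one at a time; those treated before are excluded. -/
def branch (g : List ℕ → List ℕ → Bool) (S : List ℕ) : List ℕ → List ℕ → Bool
  | [], _ => true
  | f :: E, r => cond (moveAll E r (g (f :: S))) (branch g S E r) false

/-- The first list is longer than the second one. -/
def longer : List ℕ → List ℕ → Bool
  | [], _ => false
  | _ :: _, [] => true
  | _ :: l, _ :: l' => longer l l'

/-- Every set `T` of codes with `S ⊆ T ⊆ S ∪ C` for which there are synchronizing words, but none of
length at most eight, satisfies `accept`. If `S` has no synchronizing words, then `T` contains an
element which does not preserve a family of masks that is closed under `S`. -/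
def search (accept : List ℕ → Bool) : ℕ → List ℕ → List ℕ → Bool
  | 0, _, _ => false
  -- The number 32768 is `2 ^ 15`, the set holding only the full mask, and 65256 is `2 ^ 16 - 1 -
  -- 279`, all masks with at least two elements. There are 11 such masks, so 11 rounds suffice for
  -- both closures: `R` is the least closed family containing the full set, `F` the greatest one
  -- without singletons. Each has to be left; the one with fewer escaping candidates is used.
  | n + 1, S, C => split (fun t => short (t :: S)) C [] [] fun _ C' =>
      bfs (fun _ => cond (accept S) (branch (search accept n) S C' []) false)
        (fun R => shrink S 11 65256 fun F =>
          split (escapes R) C' [] [] fun E r =>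
          split (escapes F) C' [] [] fun E' r' =>
          cond (longer E E')
            (cond (closedUnder F S) (branch (search accept n) S E' r') false)
            (cond (closedUnder R S) (branch (search accept n) S E r) false))
        S 11 32768 [15]

/-- The mask reached from the full set after processing a word. -/
def eval (w : List ℕ) : ℕ := w.foldl (fun m t => act t m) 15

/-- Some word over `T` of length at most `k` leads from the full set to a singleton. -/
def SyncWithin (T : Set ℕ) (k : ℕ) : Prop :=
  ∃ w : List ℕ, (∀ t ∈ w, t ∈ T) ∧ w.length ≤ k ∧ hasBit points (eval w) = true

/-! ### Soundness of the search -/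

theorem SyncWithin.mono {T T' : Set ℕ} {k : ℕ} (h : SyncWithin T k) (hT : T ⊆ T') :
    SyncWithin T' k := by
  obtain ⟨w, hw, hk⟩ := h
  exact ⟨w, fun t ht => hT (hw t ht), hk⟩

theorem eval_append_singleton (w : List ℕ) (t : ℕ) : eval (w ++ [t]) = act t (eval w) := by
  simp [eval]

theorem act_lt (t m : ℕ) : act t m < 16 :=
  Nat.lt_succ_of_le (Nat.and_le_right (n := Nat.shiftRight t (Nat.mul 4 m)) (m := 15))

theorem eval_lt (w : List ℕ) : eval w < 16 := by
  induction w using List.reverseRecOn with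
  | nil => simp [eval]
  | append_singleton w t _ => rw [eval_append_singleton]; exact act_lt _ _

theorem force_eq (n : ℕ) (k : ℕ → Bool) : force n k = k n := by
  cases n <;> rfl

theorem hasBit_eq_testBit (F m : ℕ) : hasBit F m = F.testBit m := by
  have h : hasBit F m = Nat.beq ((F >>> m) &&& 1) 1 := rfl
  rw [h, Nat.testBit_eq_decide_div_mod_eq, Nat.and_one_is_mod, Nat.shiftRight_eq_div_pow]
  rcases Nat.mod_two_eq_zero_or_one (F / 2 ^ m) with h | h <;> rw [h] <;> rfl

/-- Soundness in continuation-passing form: `G` is any goal that every exit of the computation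
yields. The set `v` only prunes, so nothing has to be known about it. -/
theorem visitOne_sound {hit : Unit → Bool} {m : ℕ} {G : Prop} {S : List ℕ} {v : ℕ} {n : List ℕ}
    {k : ℕ → List ℕ → Bool}
    (hhit : (∃ t ∈ S, hasBit points (act t m) = true) → hit () = true → G)
    (hk : ∀ v' n', (∀ x ∈ n', x ∈ n ∨ ∃ t ∈ S, act t m = x) → k v' n' = true → G)
    (h : visitOne hit m S v n k = true) : G := by
  induction S generalizing v n with
  | nil => exact hk v n (fun x hx => Or.inl hx) h
  | cons t S ih =>
    have hhit' : (∃ t ∈ S, hasBit points (act t m) = true) → hit () = true → G :=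
      fun ⟨u, hu, hp⟩ => hhit ⟨u, List.mem_cons_of_mem _ hu, hp⟩
    have e : visitOne hit m (t :: S) v n k = force (act t m) fun x =>
        Bool.rec (Bool.rec (force (Nat.lor v (Nat.shiftLeft 1 x)) fun v' =>
          visitOne hit m S v' (x :: n) k) (hit ()) (hasBit points x))
          (visitOne hit m S v n k) (hasBit v x) := rfl
    rw [e, force_eq] at h
    cases hv : hasBit v (act t m) <;> rw [hv] at h
    · cases hp : hasBit points (act t m) <;> rw [hp] at h
      · simp only [force_eq] at h
        refine ih hhit' (fun v' n' hn' => hk v' n' fun x hx => ?_) h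
        rcases hn' x hx with hx | ⟨u, hu, rfl⟩
        · rcases List.mem_cons.1 hx with rfl | hx
          · exact Or.inr ⟨t, List.mem_cons_self, rfl⟩
          · exact Or.inl hx
        · exact Or.inr ⟨u, List.mem_cons_of_mem _ hu, rfl⟩
      · exact hhit ⟨t, List.mem_cons_self, hp⟩ h
    · refine ih hhit' (fun v' n' hn' => hk v' n' fun x hx => ?_) h
      exact (hn' x hx).imp_right fun ⟨u, hu, e⟩ => ⟨u, List.mem_cons_of_mem _ hu, e⟩

theorem visitAll_sound {hit : Unit → Bool} {G : Prop} {S fr : List ℕ} {v : ℕ} {n : List ℕ}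
    {k : ℕ → List ℕ → Bool}
    (hhit : (∃ m ∈ fr, ∃ t ∈ S, hasBit points (act t m) = true) → hit () = true → G)
    (hk : ∀ v' n', (∀ x ∈ n', x ∈ n ∨ ∃ m ∈ fr, ∃ t ∈ S, act t m = x) → k v' n' = true → G)
    (h : visitAll hit S fr v n k = true) : G := by
  induction fr generalizing v n with
  | nil => exact hk v n (fun x hx => Or.inl hx) h
  | cons m fr ih =>
    have e : visitAll hit S (m :: fr) v n k =
        visitOne hit m S v n fun v' n' => visitAll hit S fr v' n' k := rfl
    rw [e] at h
    refine visitOne_sound (fun hp => hhit ⟨m, List.mem_cons_self, hp⟩) (fun v' n' hn' h' => ?_) h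
    refine ih (fun ⟨x, hx, hp⟩ => hhit ⟨x, List.mem_cons_of_mem _ hx, hp⟩)
      (fun v'' n'' hn'' => hk v'' n'' fun x hx => ?_) h'
    rcases hn'' x hx with hx | ⟨y, hy, hp⟩
    · exact (hn' x hx).imp_right fun hp => ⟨m, List.mem_cons_self, hp⟩
    · exact Or.inr ⟨y, List.mem_cons_of_mem _ hy, hp⟩

/-- The invariant is that every frontier mask is reached by a word of length at most `j`. The final
set `v` is unconstrained, since `closedUnder` later verifies whatever family is used; the same
applies to `shrink_sound`. -/
theorem bfs_sound {hit : Unit → Bool} {fin : ℕ → Bool} {G : Prop} {S : List ℕ} {N : ℕ}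
    (hhit : SyncWithin {t | t ∈ S} N → hit () = true → G) (hfin : ∀ v, fin v = true → G)
    {K j v : ℕ} {fr : List ℕ} (hj : j + K ≤ N)
    (hfr : ∀ x ∈ fr, ∃ w : List ℕ, (∀ t ∈ w, t ∈ S) ∧ w.length ≤ j ∧ eval w = x)
    (h : bfs hit fin S K v fr = true) : G := by
  have step : ∀ x ∈ fr, ∀ t ∈ S,
      ∃ w : List ℕ, (∀ t ∈ w, t ∈ S) ∧ w.length ≤ j + 1 ∧ eval w = act t x := by
    intro x hx t ht
    obtain ⟨w, hw, hl, rfl⟩ := hfr x hx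
    refine ⟨w ++ [t], ?_, by simpa using hl, eval_append_singleton w t⟩
    simpa [or_imp, forall_and] using ⟨hw, ht⟩
  induction K generalizing j v fr with
  | zero => exact hfin v h
  | succ K ih =>
    have e : bfs hit fin S (K + 1) v fr = visitAll hit S fr v [] (bfs hit fin S K) := rfl
    rw [e] at h
    refine visitAll_sound ?_ (fun v' n' hn' h' => ?_) h
    · rintro ⟨x, hx, t, ht, hp⟩
      obtain ⟨w, hw, hl, hx'⟩ := step x hx t ht
      exact hhit ⟨w, hw, by omega, hx' ▸ hp⟩
    · have hn : ∀ x ∈ n', ∃ w : List ℕ, (∀ t ∈ w, t ∈ S) ∧ w.length ≤ j + 1 ∧ eval w = x := by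
        intro x hx
        obtain hx | ⟨y, hy, t, ht, rfl⟩ := hn' x hx
        · simp at hx
        · exact step y hy t ht
      refine ih (by omega) hn h' ?_
      intro x hx t ht
      obtain ⟨w, hw, hl, rfl⟩ := hn x hx
      refine ⟨w ++ [t], ?_, by simpa using hl, eval_append_singleton w t⟩
      simpa [or_imp, forall_and] using ⟨hw, ht⟩

theorem short_sound {S : List ℕ} (h : short S = true) : SyncWithin {t | t ∈ S} 8 := by
  refine bfs_sound (j := 0) (K := 8) (N := 8) (fun hs _ => hs) (fun v hv => ?_) le_rfl ?_ h
  · simp at hv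
  · exact fun x hx => ⟨[], by simp, by simp, (List.mem_singleton.1 hx).symm⟩

theorem shrinkOnce_sound {S ms : List ℕ} {F : ℕ} {k : ℕ → Bool} {G : Prop}
    (hk : ∀ F', k F' = true → G) (h : shrinkOnce S ms F k = true) : G := by
  induction ms generalizing F with
  | nil => exact hk F h
  | cons m ms ih =>
    have e : shrinkOnce S (m :: ms) F k = Bool.rec (shrinkOnce S ms F k)
      (Bool.rec (shrinkOnce S ms F k) (force (Nat.sub F (Nat.shiftLeft 1 m)) fun F' =>
        shrinkOnce S ms F' k) (leaves F m S)) (hasBit F m) := rfl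
    rw [e] at h
    cases hF : hasBit F m <;> rw [hF] at h
    · exact ih h
    · cases hl : leaves F m S <;> rw [hl] at h
      · exact ih h
      · simp only [force_eq] at h
        exact ih h

theorem shrink_sound {S : List ℕ} {n F : ℕ} {k : ℕ → Bool} {G : Prop}
    (hk : ∀ F', k F' = true → G) (h : shrink S n F k = true) : G := by
  induction n generalizing F with
  | zero => exact hk F h
  | succ n ih =>
    refine shrinkOnce_sound (fun F' h' => ?_) h
    cases hb : Nat.beq F F' <;> rw [hb] at h'
    · exact ih h'
    · exact hk F h'

/-- The binary digits of 279 mark the empty set and the four singletons. -/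
theorem mem_masks_of_hasBit {F m : ℕ} (hF : Nat.land F 279 = 0) (hm : m < 16)
    (h : hasBit F m = true) : m ∈ masks := by
  have key : (279 : ℕ).testBit m = false := by
    by_contra h'
    have h1 : (F &&& 279).testBit m = true := by
      rw [Nat.testBit_and, ← hasBit_eq_testBit, h, Bool.true_and]
      simpa using h'
    have h2 : F &&& 279 = 0 := hF
    simp [h2] at h1
  clear h hF
  decide +revert

theorem escapesFrom_eq_false {F t : ℕ} {ms : List ℕ} (h : escapesFrom F t ms = false) :
    ∀ m ∈ ms, hasBit F m = true → hasBit F (act t m) = true := by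
  induction ms with
  | nil => simp
  | cons m ms ih =>
    have e : escapesFrom F t (m :: ms) = Bool.rec (escapesFrom F t ms)
      (Bool.rec true (escapesFrom F t ms) (hasBit F (act t m))) (hasBit F m) := rfl
    rw [e] at h
    cases hm : hasBit F m <;> rw [hm] at h
    · simpa [hm] using ih h
    · cases ha : hasBit F (act t m) <;> rw [ha] at h
      · simp at h
      · simpa [ha] using ih h

/-- Otherwise all masks reached from the full set stay in `F`, which contains no singleton. -/
theorem exists_escapes {F : ℕ} {T : Set ℕ} {k : ℕ} (h15 : hasBit F 15 = true)
    (hF : Nat.land F 279 = 0) (hT : SyncWithin T k) : ∃ t ∈ T, escapes F t = true := by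
  by_contra! hne
  obtain ⟨w, hw, -, hp⟩ := hT
  have hinv : hasBit F (eval w) = true := by
    clear hp
    induction w using List.reverseRecOn with
    | nil => exact h15
    | append_singleton w t ih =>
      simp only [List.mem_append, List.mem_singleton] at hw
      have ih := ih fun u hu => hw u (Or.inl hu)
      rw [eval_append_singleton]
      exact escapesFrom_eq_false (Bool.eq_false_of_not_eq_true (hne t (hw t (Or.inr rfl)))) _
        (mem_masks_of_hasBit hF (eval_lt w) ih) ih
  have hm := mem_masks_of_hasBit hF (eval_lt w) hinv
  have : ∀ m ∈ masks, hasBit points m = false := by decide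
  simp [this _ hm] at hp

theorem split_sound {p : ℕ → Bool} {C y n : List ℕ} {k : List ℕ → List ℕ → Bool} {G : Prop}
    (hk : ∀ y' n', (∀ t, t ∈ y' ↔ t ∈ y ∨ t ∈ C ∧ p t = true) →
      (∀ t, t ∈ n' ↔ t ∈ n ∨ t ∈ C ∧ p t = false) → k y' n' = true → G)
    (h : split p C y n k = true) : G := by
  induction C generalizing y n with
  | nil => exact hk y n (by simp) (by simp) h
  | cons t C ih =>
    rw [split] at h
    cases hp : p t <;> rw [hp] at h
    · refine ih (fun y' n' hy hn => hk y' n' (fun u => ?_) fun u => ?_) h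
      · rw [hy u, List.mem_cons]
        constructor
        · tauto
        · rintro (h | ⟨rfl | h, hu⟩)
          · exact Or.inl h
          · simp [hp] at hu
          · exact Or.inr ⟨h, hu⟩
      · rw [hn u, List.mem_cons, List.mem_cons]
        constructor
        · rintro ((rfl | h) | h)
          · exact Or.inr ⟨Or.inl rfl, hp⟩
          · exact Or.inl h
          · exact Or.inr ⟨Or.inr h.1, h.2⟩
        · tauto
    · refine ih (fun y' n' hy hn => hk y' n' (fun u => ?_) fun u => ?_) h
      · rw [hy u, List.mem_cons, List.mem_cons]
        constructor
        · rintro ((rfl | h) | h)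
          · exact Or.inr ⟨Or.inl rfl, hp⟩
          · exact Or.inl h
          · exact Or.inr ⟨Or.inr h.1, h.2⟩
        · tauto
      · rw [hn u, List.mem_cons]
        constructor
        · tauto
        · rintro (h | ⟨rfl | h, hu⟩)
          · exact Or.inl h
          · simp [hp] at hu
          · exact Or.inr ⟨h, hu⟩

theorem moveAll_eq (C r : List ℕ) (k : List ℕ → Bool) :
    moveAll C r k = k (C.reverse ++ r) := by
  induction C generalizing r with
  | nil => rfl
  | cons t C ih => rw [moveAll, ih]; simp

/-- If `T` lies between `S` and `S ∪ C` and has synchronizing words, but none of length at most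
eight, then `accept` holds for a list with the same elements as `T`. -/
def Sound (accept : List ℕ → Bool) (S C : List ℕ) : Prop :=
  ∀ T : Set ℕ, (∀ s ∈ S, s ∈ T) → (∀ t ∈ T, t ∈ S ∨ t ∈ C) → (∃ k, SyncWithin T k) →
    ¬ SyncWithin T 8 → ∃ L, accept L = true ∧ ∀ t, t ∈ T ↔ t ∈ L

/-- Either the first `f ∈ E` in `T` is added to `S`, and `g` settles the case, or no element of `E`
lies in `T`, which is the second alternative. -/
theorem branch_sound {accept : List ℕ → Bool} {g : List ℕ → List ℕ → Bool} {S E r : List ℕ}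
    (hg : ∀ S C, g S C = true → Sound accept S C) (h : branch g S E r = true) {T : Set ℕ}
    (hS : ∀ s ∈ S, s ∈ T) (hT : ∀ t ∈ T, t ∈ S ∨ t ∈ E ∨ t ∈ r) (hsync : ∃ k, SyncWithin T k)
    (hlong : ¬ SyncWithin T 8) :
    (∃ L, accept L = true ∧ ∀ t, t ∈ T ↔ t ∈ L) ∨ ∀ t ∈ T, t ∈ S ∨ t ∈ r := by
  induction E with
  | nil => right; simpa using hT
  | cons f E ih =>
    rw [branch] at h
    cases hm : moveAll E r (g (f :: S)) <;> rw [hm] at h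
    · simp at h
    · by_cases hf : f ∈ T
      · left
        rw [moveAll_eq] at hm
        refine hg _ _ hm T ?_ (fun t ht => ?_) hsync hlong
        · simpa using ⟨hf, hS⟩
        · have := hT t ht
          simp only [List.mem_cons, List.mem_append, List.mem_reverse] at this ⊢
          tauto
      · refine ih h fun t ht => ?_
        have := hT t ht
        rw [List.mem_cons] at this
        rcases this with h | (rfl | h) | h
        · exact Or.inl h
        · exact absurd ht hf
        · exact Or.inr (Or.inl h)
        · exact Or.inr (Or.inr h)

/-- The second alternative of `branch_sound` is impossible: `T` has an element escaping `F`, while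
neither `S` nor `r` contains one. -/
theorem branch_closed_sound {accept : List ℕ → Bool} {g : List ℕ → List ℕ → Bool} {F : ℕ}
    {S C E r : List ℕ} (hg : ∀ S C, g S C = true → Sound accept S C)
    (hE : ∀ t, t ∈ E ↔ t ∈ [] ∨ t ∈ C ∧ escapes F t = true)
    (hr : ∀ t, t ∈ r ↔ t ∈ [] ∨ t ∈ C ∧ escapes F t = false)
    (h : cond (closedUnder F S) (branch g S E r) false = true) : Sound accept S C := by
  intro T hS hT hsync hlong
  cases hc : closedUnder F S <;> rw [hc] at h
  · simp at h
  · rw [closedUnder] at hc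
    cases h15 : hasBit F 15 <;> rw [h15] at hc
    · simp at hc
    cases hF : Nat.beq (Nat.land F 279) 0 <;> rw [hF] at hc
    · simp at hc
    refine (branch_sound hg h hS (fun t ht => ?_) hsync hlong).resolve_right fun hall => ?_
    · refine (hT t ht).imp_right fun htC => ?_
      rw [hE, hr]
      cases he : escapes F t <;> simp [htC]
    · obtain ⟨k, hk⟩ := hsync
      obtain ⟨t, ht, he⟩ := exists_escapes h15 (Nat.eq_of_beq_eq_true hF) hk
      rcases hall t ht with htS | htr
      · have : ∀ t ∈ S, escapes F t = false := by simpa using hc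
        simp [this t htS] at he
      · simpa [he] using (hr t).1 htr

theorem search_sound (accept : List ℕ → Bool) (n : ℕ) (S C : List ℕ)
    (h : search accept n S C = true) : Sound accept S C := by
  induction n generalizing S C with
  | zero => simp [search] at h
  | succ n ih =>
    refine split_sound (fun Y C' hY hC' h => ?_) h
    suffices hs : Sound accept S C' by
      intro T hS hT hsync hlong
      refine hs T hS (fun t ht => (hT t ht).imp_right fun htC => ?_) hsync hlong
      rw [hC']
      refine Or.inr ⟨htC, ?_⟩
      -- A discarded candidate in `T` would give `T` a word of length at most eight.
      by_contra hne
      refine hlong ((short_sound (by simpa using hne)).mono ?_)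
      intro u hu
      rcases List.mem_cons.1 hu with rfl | hu
      · exact ht
      · exact hS u hu
    refine bfs_sound (j := 0) (K := 11) (N := 11) (fun _ h => ?_) (fun R h => ?_) le_rfl ?_ h
    · intro T hS hT hsync hlong
      cases ha : accept S <;> rw [ha] at h
      · simp at h
      · rcases branch_sound ih h hS (fun t ht => (hT t ht).imp_right Or.inl) hsync hlong with h | h
        · exact h
        -- No further candidate lies in `T`, hence `T = S`.
        · exact ⟨S, ha, fun t => ⟨fun ht => by simpa using h t ht, hS t⟩⟩
    · refine shrink_sound (fun F h => ?_) h
      refine split_sound (fun E r hE hr h => ?_) h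
      refine split_sound (fun E' r' hE' hr' h => ?_) h
      cases hl : longer E E' <;> rw [hl] at h
      · exact branch_closed_sound ih hE hr h
      · exact branch_closed_sound ih hE' hr' h
    · exact fun x hx => ⟨[], by simp, by simp, (List.mem_singleton.1 hx).symm⟩

end TransformationCode

/-! ### Automata as sets of codes -/

namespace TransformationCode

/-- The number that represents a set of points. -/
def mask (s : Finset (Fin 4)) : ℕ := ∑ i ∈ s, 2 ^ (i : ℕ)

/-- The code of a transformation: its digit in base 16 at the position `mask s` is
`mask (s.image f)`. The table is doubled in length for each of the four points. -/
def encode (f : Fin 4 → Fin 4) : ℕ :=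
  let t₁ := Nat.shiftLeft (Nat.shiftLeft 1 (f 0).1) 4
  let t₂ := Nat.lor t₁ (Nat.shiftLeft (Nat.lor t₁ (Nat.mul 0x11 (Nat.shiftLeft 1 (f 1).1))) 8)
  let t₃ := Nat.lor t₂ (Nat.shiftLeft (Nat.lor t₂ (Nat.mul 0x1111 (Nat.shiftLeft 1 (f 2).1))) 16)
  Nat.lor t₃ (Nat.shiftLeft (Nat.lor t₃ (Nat.mul 0x11111111 (Nat.shiftLeft 1 (f 3).1))) 32)

/-- The code of the identity. -/
def idCode : ℕ := encode id

/-- The code of the transformation induced by a symbol, with the states numbered by `e`. -/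
def code {Q : Type u} {A : Type v} (M : Automaton Q A) (e : Q ≃ Fin 4) (a : A) : ℕ :=
  encode fun i => e (M.step (e.symm i) a)

/-- The codes of the transformations induced by the symbols, except for the identity. -/
def codes {Q : Type u} {A : Type v} (M : Automaton Q A) (e : Q ≃ Fin 4) : Set ℕ :=
  {t | (∃ a, code M e a = t) ∧ t ≠ idCode}

theorem eq_vec (f : Fin 4 → Fin 4) : f = ![f 0, f 1, f 2, f 3] :=
  (FinVec.etaExpand_eq f).symm

theorem act_encode (f : Fin 4 → Fin 4) (s : Finset (Fin 4)) :
    act (encode f) (mask s) = mask (s.image f) := by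
  have key : ∀ a b c d : Fin 4, ∀ s : Finset (Fin 4),
      act (encode ![a, b, c, d]) (mask s) = mask (s.image ![a, b, c, d]) := by
    decide +kernel
  rw [eq_vec f]
  exact key _ _ _ _ s

theorem encode_injective : Function.Injective encode := by
  intro f g h
  funext i
  have h1 : mask (({i} : Finset (Fin 4)).image f) = mask (({i} : Finset (Fin 4)).image g) := by
    rw [← act_encode, ← act_encode, h]
  simp only [mask, Finset.image_singleton, Finset.sum_singleton] at h1
  exact Fin.ext (Nat.pow_right_injective le_rfl h1)

theorem act_idCode {m : ℕ} (hm : m < 16) : act idCode m = m := by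
  decide +revert

theorem hasBit_points_mask (s : Finset (Fin 4)) :
    hasBit points (mask s) = true ↔ s.card = 1 := by
  decide +revert

theorem eval_map_code {Q : Type u} {A : Type v} (M : Automaton Q A) (e : Q ≃ Fin 4) (w : List A) :
    eval (w.map (code M e)) = mask (Finset.univ.image fun i => e (M.run (e.symm i) w)) := by
  induction w using List.reverseRecOn with
  | nil => simp [eval, Automaton.run]; rfl
  | append_singleton w a ih =>
    rw [List.map_append, List.map_singleton, eval_append_singleton, ih, code, act_encode,
      Finset.image_image]
    congr 2
    funext i
    simp [Automaton.run]

theorem isSynchronizingWord_iff {Q : Type u} {A : Type v} (M : Automaton Q A) (e : Q ≃ Fin 4)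
    (w : List A) :
    M.IsSynchronizingWord w ↔ hasBit points (eval (w.map (code M e))) = true := by
  rw [eval_map_code, hasBit_points_mask, Finset.card_eq_one]
  constructor
  · rintro ⟨s, hs⟩
    refine ⟨e s, ?_⟩
    simp only [hs]
    exact Finset.image_const Finset.univ_nonempty _
  · rintro ⟨j, hj⟩
    refine ⟨e.symm j, fun q => e.injective ?_⟩
    have : e (M.run (e.symm (e q)) w) ∈ ({j} : Finset (Fin 4)) :=
      hj ▸ Finset.mem_image_of_mem _ (Finset.mem_univ (e q))
    simpa using this

theorem eval_filter_ne_idCode (w : List ℕ) : eval (w.filter (· ≠ idCode)) = eval w := by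
  induction w using List.reverseRecOn with
  | nil => rfl
  | append_singleton w t ih =>
    rw [List.filter_append, eval_append_singleton, ← ih]
    by_cases ht : t = idCode
    · subst ht
      simp [act_idCode (eval_lt _)]
    · rw [List.filter_singleton]
      simp only [ht, ne_eq, not_false_eq_true, decide_true, cond_true]
      exact eval_append_singleton _ _

/-- Deleting identity symbols from a word changes no image and does not lengthen it. Thus automata
that are not basic are covered as well. -/
theorem syncWithin_codes_iff {Q : Type u} {A : Type v} (M : Automaton Q A) (e : Q ≃ Fin 4)
    (k : ℕ) :
    SyncWithin (codes M e) k ↔ ∃ w : List A, M.IsSynchronizingWord w ∧ w.length ≤ k := by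
  constructor
  · rintro ⟨w, hw, hk, hp⟩
    have hw' : w ∈ Set.range (List.map (code M e)) := by
      rw [Set.range_list_map]
      exact fun t ht => (hw t ht).1
    obtain ⟨w, rfl⟩ := hw'
    exact ⟨w, (isSynchronizingWord_iff M e w).2 hp, by simpa using hk⟩
  · rintro ⟨w, hw, hk⟩
    refine ⟨(w.map (code M e)).filter (· ≠ idCode), fun t ht => ?_, ?_, ?_⟩
    · simp only [List.mem_filter, List.mem_map, decide_eq_true_eq] at ht
      exact ⟨ht.1.imp fun a ha => ha.2, ht.2⟩
    · exact (List.length_filter_le _ _).trans (by simpa using hk)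
    · rw [eval_filter_ne_idCode]
      exact (isSynchronizingWord_iff M e w).1 hw

theorem hasSyncLength_nine_iff {Q : Type u} {A : Type v} (M : Automaton Q A) (e : Q ≃ Fin 4) :
    M.HasSyncLength 9 ↔ SyncWithin (codes M e) 9 ∧ ¬ SyncWithin (codes M e) 8 := by
  rw [syncWithin_codes_iff, syncWithin_codes_iff]
  constructor
  · rintro ⟨⟨w, hw, hl⟩, hlow⟩
    refine ⟨⟨w, hw, hl.le⟩, fun ⟨w', hw', hl'⟩ => ?_⟩
    have := hlow ⟨w', hw', rfl⟩
    omega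
  · rintro ⟨⟨w, hw, hl⟩, hno⟩
    have hlow : ∀ w' : List A, M.IsSynchronizingWord w' → 9 ≤ w'.length := fun w' hw' => by
      by_contra h
      exact hno ⟨w', hw', by omega⟩
    exact ⟨⟨w, hw, le_antisymm hl (hlow w hw)⟩, by rintro _ ⟨w', hw', rfl⟩; exact hlow w' hw'⟩

/-! ### The classification by search -/

/-- All permutations of the four points. -/
def perms : List (Equiv.Perm (Fin 4)) := do
  let i ← [0, 1, 2, 3]
  let j ← [1, 2, 3]
  let k ← [2, 3]
  return Equiv.swap 0 i * Equiv.swap 1 j * Equiv.swap 2 k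

/-- The codes of the conjugates of `r`. -/
def orbit (r : Fin 4 → Fin 4) : List ℕ :=
  perms.map fun σ : Equiv.Perm (Fin 4) => encode (σ ∘ r ∘ σ.symm)

/-- Add the elements of a list to `C`, without repetitions. -/
def collect : List ℕ → List ℕ → (List ℕ → Bool) → Bool
  | [], C, k => k C
  | t :: l, C, k => force t fun u => cond (C.any (Nat.beq u)) (collect l C k) (collect l (u :: C) k)

/-- Families of sets of codes: the subsets of the first list that include one of the lists in the
second one. -/
def families : List (List ℕ × List (List ℕ)) :=
  let c := code automatonA4 (Equiv.refl _)
  let d := code automatonT42 (Equiv.refl _)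
  let g := code (cernyAutomaton 4) (Equiv.refl _)
  -- The search fixes the representative `![1, 1, 2, 3]`, the symbol `b` of `C_4`. The swap of 2 and
  -- 3 commutes with it, so `C_4` turns up in two numberings.
  let h := code (cernyAutomaton 4) (Equiv.swap 2 3)
  [([c .a, c .b, c .c, c .d, c .e], [[c .a, c .b], [c .b, c .d, c .e]]),
    ([d .a, d .b, d .c], [[d .a, d .b, d .c]]),
    ([g .a, g .b], [[g .a, g .b]]),
    ([h .a, h .b], [[h .a, h .b]])]

/-- The set of codes belongs to one of the families. -/
def accept (S : List ℕ) : Bool :=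
  families.any fun p => (S.all fun t => p.1.any (Nat.beq t)) &&
    p.2.any fun K => K.all fun t => S.any (Nat.beq t)

/-- Search for the sets of codes that contain a conjugate of one of the transformations in the
list; those treated before are excluded. At the end all codes have to be covered. -/
def checkAll : List (Fin 4 → Fin 4) → List ℕ → Bool
  | [], C => [0, 1, 2, 3].all fun a => [0, 1, 2, 3].all fun b => [0, 1, 2, 3].all fun c =>
      [0, 1, 2, 3].all fun d => (idCode :: C).any (Nat.beq (encode ![a, b, c, d]))
  | r :: rs, C => collect (orbit r) C fun C' => force (encode r) fun t =>
      cond (cond (short [t]) true (search accept 12 [t] (C'.filter fun u => !Nat.beq u t)))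
        (checkAll rs C') false

/-- Representatives of the conjugacy classes of the transformations that are not bijective. -/
def representatives : List (Fin 4 → Fin 4) :=
  [![1, 1, 2, 3], ![1, 0, 0, 1], ![0, 0, 3, 2], ![2, 1, 0, 2], ![3, 2, 0, 2], ![1, 0, 0, 0],
    ![0, 0, 2, 2], ![0, 0, 0, 3], ![1, 0, 0, 2], ![0, 0, 1, 3], ![0, 0, 1, 2], ![0, 0, 1, 1],
    ![0, 0, 0, 1], ![0, 0, 0, 0]]

/-- The search through all sets of codes. -/
def check : Bool :=
  collect (perms.map fun σ : Equiv.Perm (Fin 4) => encode σ) [] fun C =>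
    checkAll representatives (C.filter fun u => !Nat.beq u idCode)

theorem check_eq_true : check = true := by
  decide +kernel

theorem collect_sound {l C : List ℕ} {k : List ℕ → Bool} {G : Prop}
    (hk : ∀ C', (∀ t ∈ C', t ∈ l ∨ t ∈ C) → k C' = true → G) (h : collect l C k = true) : G := by
  induction l generalizing C with
  | nil => exact hk C (by simp) h
  | cons t l ih =>
    rw [collect, force_eq] at h
    cases hb : C.any (Nat.beq t) <;> rw [hb] at h
    · refine ih (fun C' hC' => hk C' fun u hu => ?_) h
      have := hC' u hu
      simp only [List.mem_cons] at this ⊢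
      tauto
    · refine ih (fun C' hC' => hk C' fun u hu => ?_) h
      have := hC' u hu
      simp only [List.mem_cons] at this ⊢
      tauto

theorem nat_beq_iff (m n : ℕ) : Nat.beq m n = true ↔ m = n :=
  ⟨Nat.eq_of_beq_eq_true, fun h => h ▸ Nat.beq_refl m⟩

theorem accept_iff (S : List ℕ) : accept S = true ↔
    ∃ p ∈ families, (∀ t ∈ S, t ∈ p.1) ∧ ∃ K ∈ p.2, ∀ t ∈ K, t ∈ S := by
  simp only [accept, List.any_eq_true, List.all_eq_true, Bool.and_eq_true, nat_beq_iff,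
    exists_eq_right']

/-- Consider the last class in the list that the codes meet in some numbering. After renumbering,
its representative is a symbol, and all codes lie in the pool `C'` of bijections and classes up to
that one. `hC` covers the case that no class from the remaining list is met. -/
theorem checkAll_sound {Q : Type u} {A : Type v} (M : Automaton Q A)
    (hsync : ∃ w, M.IsSynchronizingWord w) (hlong : ∀ w, M.IsSynchronizingWord w → 8 < w.length)
    {rs : List (Fin 4 → Fin 4)} {C : List ℕ} (h : checkAll rs C = true)
    (hC : (∀ e, ∀ t ∈ codes M e, t ∈ C) →
      ∃ e, ∃ L, accept L = true ∧ ∀ t, t ∈ codes M e ↔ t ∈ L) :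
    ∃ e, ∃ L, accept L = true ∧ ∀ t, t ∈ codes M e ↔ t ∈ L := by
  have hlong' : ∀ e, ¬ SyncWithin (codes M e) 8 := by
    intro e he
    obtain ⟨w, hw, hl⟩ := (syncWithin_codes_iff M e 8).1 he
    exact absurd (hlong w hw) (by omega)
  induction rs generalizing C with
  | nil =>
    refine hC fun e t ⟨⟨a, ha⟩, ht⟩ => ?_
    have key : ∀ a ∈ ([0, 1, 2, 3] : List (Fin 4)), ∀ b ∈ ([0, 1, 2, 3] : List (Fin 4)),
        ∀ c ∈ ([0, 1, 2, 3] : List (Fin 4)), ∀ d ∈ ([0, 1, 2, 3] : List (Fin 4)),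
        encode ![a, b, c, d] ∈ idCode :: C := by
      simpa only [checkAll, List.all_eq_true, List.any_eq_true, nat_beq_iff,
        exists_eq_right'] using h
    have hall : ∀ i : Fin 4, i ∈ ([0, 1, 2, 3] : List (Fin 4)) := by decide
    have := key _ (hall (e (M.step (e.symm 0) a))) _ (hall (e (M.step (e.symm 1) a)))
      _ (hall (e (M.step (e.symm 2) a))) _ (hall (e (M.step (e.symm 3) a)))
    rw [← eq_vec fun i => e (M.step (e.symm i) a)] at this
    exact (List.mem_cons.1 this).elim (fun h => absurd (ha.symm.trans h) ht) fun h => ha ▸ h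
  | cons r rs ih =>
    refine collect_sound (fun C' hC' h => ?_) h
    rw [force_eq] at h
    cases hr : cond (short [encode r]) true
      (search accept 12 [encode r] (C'.filter fun u => !Nat.beq u (encode r))) <;> rw [hr] at h
    · simp at h
    refine ih h fun hall => ?_
    by_cases hex : ∃ e, ∃ t ∈ codes M e, t ∈ orbit r
    · obtain ⟨e, t, ⟨⟨a, ha⟩, ht⟩, hto⟩ := hex
      obtain ⟨σ, -, rfl⟩ := List.mem_map.1 hto
      -- Renumbering by `σ⁻¹` turns the conjugate `σ ∘ r ∘ σ⁻¹` into `r`.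
      have hra : (fun i => (e.trans σ.symm) (M.step ((e.trans σ.symm).symm i) a)) = r := by
        have := encode_injective ha
        funext i
        have hi := congrFun this (σ i)
        simp only [Function.comp_apply, Equiv.symm_apply_apply] at hi
        simp [hi]
      have hmem : encode r ∈ codes M (e.trans σ.symm) := by
        refine ⟨⟨a, congrArg encode hra⟩, fun hid => ht ?_⟩
        rw [encode_injective hid, idCode]
        congr 1
        funext i
        simp
      refine ⟨e.trans σ.symm, ?_⟩
      cases hs : short [encode r] <;> rw [hs] at hr
      · refine search_sound accept _ _ _ hr (codes M (e.trans σ.symm)) (by simpa using hmem)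
          (fun t ht => ?_) ?_ (hlong' _)
        · by_cases htr : t = encode r
          · simp [htr]
          · right
            simp only [List.mem_filter, Bool.not_eq_true', ← Bool.not_eq_true, nat_beq_iff]
            exact ⟨hall _ t ht, htr⟩
        · obtain ⟨w, hw⟩ := hsync
          exact ⟨w.length, (syncWithin_codes_iff M _ _).2 ⟨w, hw, le_rfl⟩⟩
      · exact absurd ((short_sound hs).mono (by simpa using hmem)) (hlong' _)
    · exact hC fun e t ht => (hC' t (hall e t ht)).resolve_left fun h => hex ⟨e, t, ht, h⟩

theorem exists_accept {Q : Type u} {A : Type v} (M : Automaton Q A) (e₀ : Q ≃ Fin 4)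
    (hsync : ∃ w, M.IsSynchronizingWord w)
    (hlong : ∀ w, M.IsSynchronizingWord w → 8 < w.length) :
    ∃ e, ∃ L, accept L = true ∧ ∀ t, t ∈ codes M e ↔ t ∈ L := by
  refine collect_sound (fun C hC h => ?_) check_eq_true
  refine checkAll_sound M hsync hlong h fun hall => ?_
  obtain ⟨w, hw⟩ := hsync
  obtain ⟨w, hw, -, hp⟩ := (syncWithin_codes_iff M e₀ _).2 ⟨w, hw, le_rfl⟩
  -- If no non-bijective class is met, all symbols are permutations; these fix the full set, so no
  -- word synchronizes.
  have key : ∀ t ∈ perms.map fun σ : Equiv.Perm (Fin 4) => encode σ, act t 15 = 15 := by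
    decide +kernel
  have h15 : eval w = 15 := by
    clear hp
    induction w using List.reverseRecOn with
    | nil => rfl
    | append_singleton w t ih =>
      rw [eval_append_singleton, ih fun u hu => hw u (List.mem_append_left _ hu)]
      have := List.mem_of_mem_filter (hall e₀ t (hw t (by simp)))
      exact key t (by simpa using hC t this)
  rw [h15] at hp
  exact absurd hp (by decide)

end TransformationCode

/-! ### Invariance under isomorphism -/

namespace Automaton

theorem Isomorphic.symm {Q : Type u} {A : Type v} {Q' : Type w} {A' : Type x} {M : Automaton Q A}
    {N : Automaton Q' A'} (h : M.Isomorphic N) : N.Isomorphic M := by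
  obtain ⟨e, f, h⟩ := h
  exact ⟨e.symm, f.symm, fun q a => by rw [Equiv.symm_apply_eq, h]; simp⟩

theorem Isomorphic.exists_isSynchronizingWord {Q : Type u} {A : Type v} {Q' : Type w} {A' : Type x}
    {M : Automaton Q A} {N : Automaton Q' A'} (h : M.Isomorphic N) {k : ℕ}
    (hk : ∃ w, M.IsSynchronizingWord w ∧ w.length = k) :
    ∃ w, N.IsSynchronizingWord w ∧ w.length = k := by
  obtain ⟨e, f, h⟩ := h
  obtain ⟨w, ⟨s, hs⟩, hw⟩ := hk
  have hrun : ∀ q, N.run (e q) (w.map f) = e (M.run q w) := by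
    intro q
    clear hs hw
    induction w generalizing q with
    | nil => rfl
    | cons a w ih => exact (congrArg (fun p => N.run p (w.map f)) (h q a).symm).trans (ih _)
  refine ⟨w.map f, ⟨e s, fun q => ?_⟩, by simpa using hw⟩
  rw [← e.apply_symm_apply q, hrun, hs]

theorem Isomorphic.hasSyncLength_iff {Q : Type u} {A : Type v} {Q' : Type w} {A' : Type x}
    {M : Automaton Q A} {N : Automaton Q' A'} (h : M.Isomorphic N) (l : ℕ) :
    M.HasSyncLength l ↔ N.HasSyncLength l := by
  have : {k : ℕ | ∃ w, M.IsSynchronizingWord w ∧ w.length = k} =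
      {k : ℕ | ∃ w, N.IsSynchronizingWord w ∧ w.length = k} :=
    Set.ext fun k => ⟨h.exists_isSynchronizingWord, h.symm.exists_isSynchronizingWord⟩
  rw [HasSyncLength, HasSyncLength, this]

end Automaton

namespace TransformationCode

open Automaton

/-! ### From accepted sets of codes to the listed automata -/

theorem code_injective {Q : Type u} {A : Type v} {M : Automaton Q A} (hM : M.IsBasic)
    (e : Q ≃ Fin 4) : Function.Injective (code M e) := by
  intro a b hab
  refine hM.1 (funext fun q => e.injective ?_)
  simpa using congrFun (encode_injective hab) (e q)

theorem code_ne_idCode {Q : Type u} {A : Type v} {M : Automaton Q A} (hM : M.IsBasic)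
    (e : Q ≃ Fin 4) (a : A) : code M e a ≠ idCode := by
  intro ha
  refine hM.2 a (funext fun q => e.injective ?_)
  simpa using congrFun (encode_injective ha) (e q)

/-- For a basic automaton the codes determine the symbols and omit none, so equal code sets yield
the bijection of symbols. -/
theorem isomorphic_of_code {Q : Type u} {A : Type v} {M : Automaton Q A} (hM : M.IsBasic)
    {B : Type w} {N : Automaton (Fin 4) B} {e : Q ≃ Fin 4} {σ : Equiv.Perm (Fin 4)}
    (hN : Function.Injective (code N σ)) (h : ∀ t, t ∈ codes M e ↔ ∃ b, code N σ b = t) :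
    M.Isomorphic N := by
  have hr : Set.range (code M e) = Set.range (code N σ) := by
    ext t
    rw [Set.mem_range, Set.mem_range, ← h t]
    exact ⟨fun ⟨a, ha⟩ => ⟨⟨a, ha⟩, ha ▸ code_ne_idCode hM e a⟩, fun ht => ht.1⟩
  let f : A ≃ B := (Equiv.ofInjective _ (code_injective hM e)).trans
    ((Equiv.setCongr hr).trans (Equiv.ofInjective _ hN).symm)
  have hf : ∀ a, code N σ (f a) = code M e a := fun a =>
    Equiv.apply_ofInjective_symm hN (Equiv.setCongr hr (Equiv.ofInjective _ (code_injective hM e) a))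
  refine ⟨e.trans σ.symm, f, fun q a => ?_⟩
  have := congrFun (encode_injective (hf a)) (e q)
  simp only [Equiv.symm_apply_apply] at this
  simp [← this]

theorem restrict_code_injective (S : Finset A4Letter) :
    Function.Injective (code (automatonA4.restrict S) (Equiv.refl _)) := by
  have key : Function.Injective (code automatonA4 (Equiv.refl _)) := by
    decide +kernel
  exact fun a b hab => Subtype.ext (key hab)

/-- The families of the search belong to the listed automata. -/
theorem isomorphic_of_accept {Q : Type u} {A : Type v} {M : Automaton Q A} (hM : M.IsBasic)
    {e : Q ≃ Fin 4} {L : List ℕ} (hL : accept L = true) (h : ∀ t, t ∈ codes M e ↔ t ∈ L) :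
    M.Isomorphic (cernyAutomaton 4) ∨ M.Isomorphic automatonT42 ∨
      ∃ S ∈ keptSets, M.Isomorphic (automatonA4.restrict S) := by
  obtain ⟨p, hp, hsub, K, hK, hcore⟩ := (accept_iff L).1 hL
  simp only [families, List.mem_cons, List.not_mem_nil, or_false] at hp
  rcases hp with rfl | rfl | rfl | rfl
  · refine Or.inr (Or.inr ⟨Finset.univ.filter fun x => code automatonA4 (Equiv.refl _) x ∈ L, ?_, ?_⟩)
    · simp only [List.mem_cons, List.not_mem_nil, or_false] at hK
      simp only [keptSets, Finset.mem_filter, Finset.mem_univ, true_and]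
      rcases hK with rfl | rfl
      · left
        simpa [Finset.insert_subset_iff] using hcore
      · right
        simpa [Finset.insert_subset_iff] using hcore
    · refine isomorphic_of_code hM (restrict_code_injective _) fun t => (h t).trans ⟨fun ht => ?_, ?_⟩
      · have : ∃ x, code automatonA4 (Equiv.refl _) x = t := by
          have := hsub t ht
          simp only [List.mem_cons, List.not_mem_nil, or_false] at this
          rcases this with rfl | rfl | rfl | rfl | rfl <;> exact ⟨_, rfl⟩
        obtain ⟨x, rfl⟩ := this
        exact ⟨⟨x, by simpa using ht⟩, rfl⟩
      · rintro ⟨⟨x, hx⟩, rfl⟩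
        exact (Finset.mem_filter.1 hx).2
  · refine Or.inr (Or.inl (isomorphic_of_code (σ := Equiv.refl _) hM (by decide +kernel) fun t =>
      (h t).trans ⟨fun ht => ?_, ?_⟩))
    · have := hsub t ht
      simp only [List.mem_cons, List.not_mem_nil, or_false] at this
      rcases this with rfl | rfl | rfl <;> exact ⟨_, rfl⟩
    · rintro ⟨x, rfl⟩
      simp only [List.mem_singleton] at hK
      subst hK
      cases x <;> exact hcore _ (by simp)
  · refine Or.inl (isomorphic_of_code (σ := Equiv.refl _) hM (by decide +kernel) fun t =>
      (h t).trans ⟨fun ht => ?_, ?_⟩)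
    · have := hsub t ht
      simp only [List.mem_cons, List.not_mem_nil, or_false] at this
      rcases this with rfl | rfl <;> exact ⟨_, rfl⟩
    · rintro ⟨x, rfl⟩
      simp only [List.mem_singleton] at hK
      subst hK
      cases x <;> exact hcore _ (by simp)
  · refine Or.inl (isomorphic_of_code (σ := Equiv.swap 2 3) hM (by decide +kernel) fun t =>
      (h t).trans ⟨fun ht => ?_, ?_⟩)
    · have := hsub t ht
      simp only [List.mem_cons, List.not_mem_nil, or_false] at this
      rcases this with rfl | rfl <;> exact ⟨_, rfl⟩
    · rintro ⟨x, rfl⟩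
      simp only [List.mem_singleton] at hK
      subst hK
      cases x <;> exact hcore _ (by simp)

/-! ### Synchronizing lengths in the families -/

theorem families_syncWithin {p : List ℕ × List (List ℕ)} (hp : p ∈ families) {K : List ℕ}
    (hK : K ∈ p.2) : SyncWithin {t | t ∈ K} 9 := by
  have key : ∀ p ∈ families, ∀ K ∈ p.2,
      bfs (fun _ => true) (fun _ => false) K 9 32768 [15] = true := by
    decide +kernel
  refine bfs_sound (j := 0) (K := 9) (N := 9) (fun hs _ => hs) (fun v hv => ?_) le_rfl ?_
    (key p hp K hK)
  · simp at hv
  · exact fun x hx => ⟨[], by simp, by simp, (List.mem_singleton.1 hx).symm⟩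

/-- A function on masks that decreases by at most one with each symbol bounds the length of
synchronizing words from below. -/
theorem not_syncWithin_of_potential {T : Set ℕ} {k : ℕ} (d : ℕ → ℕ)
    (hd : ∀ t ∈ T, ∀ m < 16, d m ≤ d (act t m) + 1) (h15 : k < d 15)
    (hpt : ∀ m < 16, hasBit points m = true → d m = 0) : ¬ SyncWithin T k := by
  rintro ⟨w, hw, hl, hp⟩
  have key : d 15 ≤ d (eval w) + w.length := by
    clear hl hp
    induction w using List.reverseRecOn with
    | nil => simp [eval]
    | append_singleton w t ih =>
      have h1 := ih fun u hu => hw u (List.mem_append_left _ hu)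
      have h2 := hd t (hw t (by simp)) _ (eval_lt w)
      rw [eval_append_singleton, List.length_append, List.length_singleton]
      omega
  have := hpt _ (eval_lt w) hp
  omega

/-- The lengths of the shortest words that lead from a set to a singleton. -/
def distances (l : List ℕ) (m : ℕ) : ℕ := l.getD m 0

theorem not_syncWithin_of_distances {L l : List ℕ}
    (h : ((∀ t ∈ L, ∀ m < 16, distances l m ≤ distances l (act t m) + 1) ∧ 8 < distances l 15) ∧
      ∀ m < 16, hasBit points m = true → distances l m = 0) : ¬ SyncWithin {t | t ∈ L} 8 :=
  not_syncWithin_of_potential (distances l) h.1.1 h.1.2 h.2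

theorem families_not_syncWithin {p : List ℕ × List (List ℕ)} (hp : p ∈ families) :
    ¬ SyncWithin {t | t ∈ p.1} 8 := by
  simp only [families, List.mem_cons, List.not_mem_nil, or_false] at hp
  rcases hp with rfl | rfl | rfl | rfl
  -- The entries are indexed by the masks 0 to 15; the entry of the full set is 9.
  · exact not_syncWithin_of_distances (l := [0, 0, 0, 3, 0, 5, 4, 8, 0, 1, 2, 4, 6, 6, 7, 9])
      (by decide +kernel)
  · exact not_syncWithin_of_distances (l := [0, 0, 0, 6, 0, 4, 2, 7, 0, 3, 1, 6, 5, 8, 5, 9])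
      (by decide +kernel)
  · exact not_syncWithin_of_distances (l := [0, 0, 0, 1, 0, 5, 4, 5, 0, 2, 6, 6, 3, 7, 8, 9])
      (by decide +kernel)
  · exact not_syncWithin_of_distances (l := [0, 0, 0, 1, 0, 2, 6, 6, 0, 5, 4, 5, 3, 7, 8, 9])
      (by decide +kernel)

/-- The core bounds the length from above, the maximal set from below. -/
theorem hasSyncLength_of_families {B : Type u} {N : Automaton (Fin 4) B}
    {p : List ℕ × List (List ℕ)} (hp : p ∈ families)
    (hsub : ∀ b, code N (Equiv.refl _) b ∈ p.1) {K : List ℕ} (hK : K ∈ p.2)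
    (hcore : ∀ t ∈ K, t ∈ codes N (Equiv.refl _)) : N.HasSyncLength 9 := by
  refine (hasSyncLength_nine_iff N (Equiv.refl _)).2 ⟨(families_syncWithin hp hK).mono hcore, ?_⟩
  intro h
  refine families_not_syncWithin hp (h.mono ?_)
  rintro _ ⟨⟨b, rfl⟩, -⟩
  exact hsub b

theorem cernyAutomaton_hasSyncLength : (cernyAutomaton 4).HasSyncLength 9 := by
  refine hasSyncLength_of_families (List.mem_of_getElem? (i := 2) rfl) (fun x => ?_)
    List.mem_cons_self ?_
  · cases x <;> simp
  · simp only [List.mem_cons, List.not_mem_nil, or_false]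
    rintro t (rfl | rfl) <;> exact ⟨⟨_, rfl⟩, by decide +kernel⟩

theorem automatonT42_hasSyncLength : automatonT42.HasSyncLength 9 := by
  refine hasSyncLength_of_families (List.mem_of_getElem? (i := 1) rfl) (fun x => ?_)
    List.mem_cons_self ?_
  · cases x <;> simp
  · simp only [List.mem_cons, List.not_mem_nil, or_false]
    rintro t (rfl | rfl | rfl) <;> exact ⟨⟨_, rfl⟩, by decide +kernel⟩

theorem restrict_hasSyncLength {S : Finset A4Letter} (hS : S ∈ keptSets) :
    (automatonA4.restrict S).HasSyncLength 9 := by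
  have hne : ∀ x, code automatonA4 (Equiv.refl _) x ≠ idCode := by
    decide +kernel
  have hmem : ∀ x ∈ S, code automatonA4 (Equiv.refl _) x ∈
      codes (automatonA4.restrict S) (Equiv.refl _) := fun x hx => ⟨⟨⟨x, hx⟩, rfl⟩, hne x⟩
  have hsub : ∀ b : {x // x ∈ S}, code (automatonA4.restrict S) (Equiv.refl _) b ∈
      [code automatonA4 (Equiv.refl _) A4Letter.a, code automatonA4 (Equiv.refl _) A4Letter.b,
        code automatonA4 (Equiv.refl _) A4Letter.c, code automatonA4 (Equiv.refl _) A4Letter.d,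
        code automatonA4 (Equiv.refl _) A4Letter.e] := by
    rintro ⟨x, hx⟩
    change code automatonA4 (Equiv.refl _) x ∈ _
    cases x <;> simp
  simp only [keptSets, Finset.mem_filter, Finset.mem_univ, true_and, Finset.insert_subset_iff,
    Finset.singleton_subset_iff] at hS
  rcases hS with ⟨ha, hb⟩ | ⟨hb, hd, he⟩
  · refine hasSyncLength_of_families (List.mem_of_getElem? (i := 0) rfl) hsub
      (List.mem_of_getElem? (i := 0) rfl) ?_
    simp only [List.mem_cons, List.not_mem_nil, or_false]
    rintro t (rfl | rfl)
    exacts [hmem _ ha, hmem _ hb]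
  · refine hasSyncLength_of_families (List.mem_of_getElem? (i := 0) rfl) hsub
      (List.mem_of_getElem? (i := 1) rfl) ?_
    simp only [List.mem_cons, List.not_mem_nil, or_false]
    rintro t (rfl | rfl | rfl)
    exacts [hmem _ hb, hmem _ hd, hmem _ he]

/-! ### Pairwise non-isomorphism inside `A4` -/

/-- No other symbol of `A4` is conjugate to `b`, and only the identity commutes with `b`. -/
theorem conjugate_b {σ : Equiv.Perm (Fin 4)} {y : A4Letter}
    (h : ∀ q, σ (automatonA4.step q .b) = automatonA4.step (σ q) y) : σ = 1 := by
  revert σ y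
  decide +kernel

/-- Every kept set contains `b`, which forces the renaming of states to be the identity; symbols
then correspond to themselves. -/
theorem subset_of_isomorphic {S T : Finset A4Letter} (hS : S ∈ keptSets)
    (h : (automatonA4.restrict S).Isomorphic (automatonA4.restrict T)) : S ⊆ T := by
  obtain ⟨σ, f, h⟩ := h
  have hb : A4Letter.b ∈ S := by
    simp only [keptSets, Finset.mem_filter, Finset.mem_univ, true_and, Finset.insert_subset_iff,
      Finset.singleton_subset_iff] at hS
    tauto
  obtain rfl := conjugate_b fun q => h q ⟨.b, hb⟩
  have key : ∀ x y, (∀ q, automatonA4.step q x = automatonA4.step q y) → x = y := by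
    decide +kernel
  intro x hx
  rw [key x (f ⟨x, hx⟩) fun q => h q ⟨x, hx⟩]
  exact (f ⟨x, hx⟩).2

end TransformationCode

/-! ### The main theorem -/

open TransformationCode
theorem mainTheorem4 :
    -- no super-critical automaton on four states exists
    (∀ (Q : Type u) (A : Type v) [Finite Q] [Finite A] (M : Automaton Q A),
      Nat.card Q = 4 → ¬ M.IsSuperCritical) ∧
    -- the basic critical automata on four states
    (∀ (Q : Type u) (A : Type v) [Finite Q] [Finite A] (M : Automaton Q A),
      Nat.card Q = 4 → M.IsBasic →
        (M.IsCritical ↔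
          M.Isomorphic (cernyAutomaton 4) ∨
          M.Isomorphic automatonT42 ∨
          ∃ S ∈ keptSets, M.Isomorphic (automatonA4.restrict S))) ∧
    -- the sub-automata of `A4` that occur are ten, pairwise non-isomorphic
    keptSets.card = 10 ∧
    (∀ S ∈ keptSets, ∀ T ∈ keptSets,
      (automatonA4.restrict S).Isomorphic (automatonA4.restrict T) → S = T) := by
  refine ⟨?_, ?_, by decide +kernel, fun S hS T hT h =>
    (subset_of_isomorphic hS h).antisymm (subset_of_isomorphic hT h.symm)⟩
  · rintro Q A _ _ M hQ ⟨l, ⟨⟨w, hw, rfl⟩, hlow⟩, hl⟩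
    have hlong : ∀ w', M.IsSynchronizingWord w' → 9 < w'.length := fun w' hw' => by
      have := hlow ⟨w', hw', rfl⟩
      rw [hQ] at hl
      omega
    obtain ⟨e, L, hL, h⟩ := exists_accept M (Finite.equivFinOfCardEq hQ) ⟨w, hw⟩
      fun w' hw' => (hlong w' hw').trans' (by norm_num)
    -- The core contained in the accepted set already has a word of length at most 9.
    obtain ⟨p, hp, -, K, hK, hcore⟩ := (accept_iff L).1 hL
    obtain ⟨w', hw', hl'⟩ := (syncWithin_codes_iff M e 9).1
      ((families_syncWithin hp hK).mono fun t ht => (h t).2 (hcore t ht))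
    exact absurd (hlong w' hw') (by omega)
  · intro Q A _ _ M hQ hM
    rw [Automaton.IsCritical, hQ]
    change M.HasSyncLength 9 ↔ _
    constructor
    · rintro ⟨⟨w, hw, -⟩, hlow⟩
      obtain ⟨e, L, hL, h⟩ := exists_accept M (Finite.equivFinOfCardEq hQ) ⟨w, hw⟩
        fun w' hw' => hlow ⟨w', hw', rfl⟩
      exact isomorphic_of_accept hM hL h
    · rintro (h | h | ⟨S, hS, h⟩)
      · exact (h.hasSyncLength_iff 9).2 cernyAutomaton_hasSyncLength
      · exact (h.hasSyncLength_iff 9).2 automatonT42_hasSyncLength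
      · exact (h.hasSyncLength_iff 9).2 (restrict_hasSyncLength hS)
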